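/- Let $\mathbf{C}$ be a unital $C^{*}$-category (a category whose morphism spaces are complex Banach spaces, with bilinear submultiplicative composition and an antilinear involution $*$ fixing objects and reversing morphisms, such that $\|f^{*}f\|=\|f\|^{2}$ and $f^{*}f$ is positive in the $C^{*}$-algebra $\mathrm{End}(X)$ for every $f\colon X\to Y$). Let $(C_i)_{i\in I}$ be a family of objects of $\mathbf{C}$ indexed by an arbitrary set, and let $X$ be an object with morphisms $e_i\colon C_i\to X$ satisfying $e_i^{*}e_i=\mathrm{id}_{C_i}$ and $e_j^{*}e_i=0$ for $i\neq j$. For an object $Z$ let $\mathbb{K}(X,Z)\subseteq \mathrm{Hom}(X,Z)$ be the closed linear span of the morphisms $g e_i^{*}$ with $i\in I$, $g\colon C_i\to Z$, and let $\mathbb{K}(Z,X)\subseteq\mathrm{Hom}(Z,X)$ be the closed linear span of the morphisms $e_i g$ with $i\in I$, $g\colon Z\to C_i$. For an object $D$ let $\mathrm{RM}(D,X)$ be the set of uniformly bounded natural transformations $\mathbb{K}(X,-)\to \mathrm{Hom}(D,-)$, and let $\mathrm{LM}(X,D)$ be the set of uniformly bounded natural transformations $\mathbb{K}(-,X)\to\mathrm{Hom}(-,D)$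 (of Banach space valued functors on $\mathbf{C}$ and $\mathbf{C}^{\mathrm{op}}$, respectively). The pair $(X,(e_i)_{i\in I})$ is called an orthogonal sum of $(C_i)_{i\in I}$ in $\mathbf{C}$ if for every object $D$ the maps $\mathrm{Hom}(D,X)\to\mathrm{RM}(D,X)$, $h\mapsto (k\mapsto kh)$, and $\mathrm{Hom}(X,D)\to \mathrm{LM}(X,D)$, $h\mapsto (k\mapsto hk)$, are bijective. **Theorem.** Let $\phi\colon\mathbf{D}\to\mathbf{C}$ be a fully faithful morphism of unital $C^{*}$-categories (a unital $\mathbb{C}$-linear $*$-functor), for instance the inclusion of a full subcategory. Let $(D_i)_{i\in I}$ be an arbitrary family of objects of $\mathbf{D}$, let $X$ be an object of $\mathbf{D}$, and let $e_i\colon D_i\to X$, $i\in I$, be morphisms of $\mathbf{D}$. 1. ($\phi$ detects orthogonal sums.) If $(\phi(X),(\phi(e_i))_{i\in I})$ is an orthogonal sum of $(\phi(D_i))_{i\in I}$ in $\mathbf{C}$, then $(X,(e_i)_{i\in I})$ is an orthogonal sum of $(D_i)_{i\in I}$ in $\mathbf{D}$. 2. ($\phi$ preserves orthogonal sums.) If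 $(X,(e_i)_{i\in I})$ is an orthogonal sum of $(D_i)_{i\in I}$ in $\mathbf{D}$ and the family $(\phi(D_i))_{i\in I}$ admits some orthogonal sum in $\mathbf{C}$, then $(\phi(X),(\phi(e_i))_{i\in I})$ is an orthogonal sum of $(\phi(D_i))_{i\in I}$ in $\mathbf{C}$. -/

import Mathlib

open CategoryTheory

universe v v₁ v₂ u u₁ u₂ w

/-- The structure of a unital `C*`-category on a category `C`: the morphism spaces are complex
Banach spaces, composition is bilinear and submultiplicative, there is an antilinear involution
`adj` (written `f ↦ f^*` on paper) which fixes the objects and reverses the morphisms, the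
`C*`-identity holds, and `f^* f` is a positive element of the `C*`-algebra of endomorphisms of
the source of `f`, that is, it is of the form `g^* g` for some endomorphism `g`.
Note that `f ≫ g` is the composition written `g f` on paper. -/
class CStarCategory (C : Type u) [Category.{v} C] where
  homNormed : ∀ X Y : C, NormedAddCommGroup (X ⟶ Y)
  homSpace : ∀ X Y : C, NormedSpace ℂ (X ⟶ Y)
  homComplete : ∀ X Y : C, CompleteSpace (X ⟶ Y)
  add_comp : ∀ {X Y Z : C} (f f' : X ⟶ Y) (g : Y ⟶ Z), (f + f') ≫ g = f ≫ g + f' ≫ g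
  comp_add : ∀ {X Y Z : C} (f : X ⟶ Y) (g g' : Y ⟶ Z), f ≫ (g + g') = f ≫ g + f ≫ g'
  smul_comp : ∀ {X Y Z : C} (c : ℂ) (f : X ⟶ Y) (g : Y ⟶ Z), (c • f) ≫ g = c • (f ≫ g)
  comp_smul : ∀ {X Y Z : C} (c : ℂ) (f : X ⟶ Y) (g : Y ⟶ Z), f ≫ (c • g) = c • (f ≫ g)
  adj : ∀ {X Y : C}, (X ⟶ Y) → (Y ⟶ X)
  adj_adj : ∀ {X Y : C} (f : X ⟶ Y), adj (adj f) = f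
  adj_comp : ∀ {X Y Z : C} (f : X ⟶ Y) (g : Y ⟶ Z), adj (f ≫ g) = adj g ≫ adj f
  adj_add : ∀ {X Y : C} (f g : X ⟶ Y), adj (f + g) = adj f + adj g
  adj_smul : ∀ {X Y : C} (c : ℂ) (f : X ⟶ Y), adj (c • f) = (starRingEnd ℂ c) • adj f
  norm_comp_le : ∀ {X Y Z : C} (f : X ⟶ Y) (g : Y ⟶ Z), ‖f ≫ g‖ ≤ ‖g‖ * ‖f‖
  norm_comp_adj : ∀ {X Y : C} (f : X ⟶ Y), ‖f ≫ adj f‖ = ‖f‖ ^ 2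
  exists_positive : ∀ {X Y : C} (f : X ⟶ Y), ∃ g : X ⟶ X, f ≫ adj f = g ≫ adj g

namespace CStarCategory

attribute [reducible] homNormed homSpace
attribute [instance] homNormed homSpace
attribute [instance] homComplete

/-- A morphism of unital `C*`-categories: a functor (preserving identities) which is complex
linear on morphism spaces and compatible with the involutions. -/
structure Morphism (D : Type u₁) [Category.{v₁} D] [CStarCategory D]
    (C : Type u₂) [Category.{v₂} C] [CStarCategory C] extends D ⥤ C where
  map_add' : ∀ {X Y : D} (f g : X ⟶ Y), map (f + g) = map f + map g
  map_smul' : ∀ {X Y : D} (c : ℂ) (f : X ⟶ Y), map (c • f) = c • map f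
  map_adj' : ∀ {X Y : D} (f : X ⟶ Y), map (adj f) = adj (map f)

variable {C : Type u} [Category.{v} C] [CStarCategory C] {I : Type w}
  {A : I → C} {X : C}

/-- Precomposition with `h` as a bounded linear map of Hom-spaces. -/
noncomputable def preComp {D Y : C} (h : D ⟶ Y) (Z : C) : (Y ⟶ Z) →L[ℂ] (D ⟶ Z) :=
  LinearMap.mkContinuous
    { toFun := fun k => h ≫ k
      map_add' := fun k k' => comp_add h k k'
      map_smul' := fun c k => comp_smul c h k }
    ‖h‖ (fun k => (norm_comp_le h k).trans_eq (mul_comm _ _))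

/-- Postcomposition with `h` as a bounded linear map of Hom-spaces. -/
noncomputable def postComp {Y D : C} (h : Y ⟶ D) (Z : C) : (Z ⟶ Y) →L[ℂ] (Z ⟶ D) :=
  LinearMap.mkContinuous
    { toFun := fun k => k ≫ h
      map_add' := fun k k' => add_comp k k' h
      map_smul' := fun c k => smul_comp c k h }
    ‖h‖ (fun k => norm_comp_le k h)

/-- The space `𝕂(X, Z)`: the norm closure in `Hom(X, Z)` of the linear span of the morphisms
of the form `g e_i^*` with `g : A i ⟶ Z`. -/
def compactFrom (e : ∀ i, A i ⟶ X) (Z : C) : Submodule ℂ (X ⟶ Z) :=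
  (Submodule.span ℂ {f | ∃ (i : I) (g : A i ⟶ Z), f = adj (e i) ≫ g}).topologicalClosure

/-- The space `𝕂(Z, X)`: the norm closure in `Hom(Z, X)` of the linear span of the morphisms
of the form `e_i g` with `g : Z ⟶ A i`. -/
def compactTo (e : ∀ i, A i ⟶ X) (Z : C) : Submodule ℂ (Z ⟶ X) :=
  (Submodule.span ℂ {f | ∃ (i : I) (g : Z ⟶ A i), f = g ≫ e i}).topologicalClosure

theorem comp_mem_compactFrom (e : ∀ i, A i ⟶ X) {Z W : C} {k : X ⟶ Z}
    (hk : k ∈ compactFrom e Z) (f : Z ⟶ W) : k ≫ f ∈ compactFrom e W := by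
  have hspan : Submodule.span ℂ {f | ∃ (i : I) (g : A i ⟶ Z), f = adj (e i) ≫ g} ≤
      (compactFrom e W).comap (postComp f X).toLinearMap := by
    rw [Submodule.span_le]
    rintro _ ⟨i, g, rfl⟩
    refine Submodule.le_topologicalClosure _ (Submodule.subset_span ⟨i, g ≫ f, ?_⟩)
    exact Category.assoc _ _ _
  have hclosed : IsClosed
      ((compactFrom e W).comap (postComp f X).toLinearMap : Set (X ⟶ Z)) :=
    (Submodule.isClosed_topologicalClosure _).preimage (postComp f X).continuous
  exact Submodule.topologicalClosure_minimal _ hspan hclosed hk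

theorem comp_mem_compactTo (e : ∀ i, A i ⟶ X) {Z W : C} {k : Z ⟶ X}
    (hk : k ∈ compactTo e Z) (f : W ⟶ Z) : f ≫ k ∈ compactTo e W := by
  have hspan : Submodule.span ℂ {f | ∃ (i : I) (g : Z ⟶ A i), f = g ≫ e i} ≤
      (compactTo e W).comap (preComp f X).toLinearMap := by
    rw [Submodule.span_le]
    rintro _ ⟨i, g, rfl⟩
    refine Submodule.le_topologicalClosure _ (Submodule.subset_span ⟨i, f ≫ g, ?_⟩)
    exact (Category.assoc _ _ _).symm
  have hclosed : IsClosed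
      ((compactTo e W).comap (preComp f X).toLinearMap : Set (Z ⟶ X)) :=
    (Submodule.isClosed_topologicalClosure _).preimage (preComp f X).continuous
  exact Submodule.topologicalClosure_minimal _ hspan hclosed hk

/-- Right multipliers from `D` to `(X, e)`: uniformly bounded natural transformations
`𝕂(X, -) → Hom(D, -)` of functors from `C` to Banach spaces. -/
@[ext]
structure RightMultiplier (e : ∀ i, A i ⟶ X) (D : C) where
  app : ∀ Z : C, compactFrom e Z →L[ℂ] (D ⟶ Z)
  bounded : ∃ K : ℝ, ∀ Z : C, ‖app Z‖ ≤ K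
  naturality : ∀ {Z W : C} (k : compactFrom e Z) (f : Z ⟶ W),
    app W ⟨k.1 ≫ f, comp_mem_compactFrom e k.2 f⟩ = app Z k ≫ f

/-- Left multipliers from `(X, e)` to `D`: uniformly bounded natural transformations
`𝕂(-, X) → Hom(-, D)` of functors from the opposite of `C` to Banach spaces. -/
@[ext]
structure LeftMultiplier (e : ∀ i, A i ⟶ X) (D : C) where
  app : ∀ Z : C, compactTo e Z →L[ℂ] (Z ⟶ D)
  bounded : ∃ K : ℝ, ∀ Z : C, ‖app Z‖ ≤ K
  naturality : ∀ {Z W : C} (k : compactTo e Z) (f : W ⟶ Z),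
    app W ⟨f ≫ k.1, comp_mem_compactTo e k.2 f⟩ = f ≫ app Z k

/-- The associated right multiplier map `Hom(D, X) → RM(D, X)`, sending `h` to the
transformation `k ↦ k h`. -/
noncomputable def rightMultiplierMap (e : ∀ i, A i ⟶ X) (D : C) (h : D ⟶ X) :
    RightMultiplier e D where
  app Z := (preComp h Z).comp (compactFrom e Z).subtypeL
  bounded := ⟨‖h‖, fun _ => ContinuousLinearMap.opNorm_le_bound _ (norm_nonneg h)
    (fun k => (norm_comp_le h k.1).trans_eq (mul_comm _ _))⟩
  naturality k f := (Category.assoc h k.1 f).symm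

/-- The associated left multiplier map `Hom(X, D) → LM(X, D)`, sending `h` to the
transformation `k ↦ h k`. -/
noncomputable def leftMultiplierMap (e : ∀ i, A i ⟶ X) (D : C) (h : X ⟶ D) :
    LeftMultiplier e D where
  app Z := (postComp h Z).comp (compactTo e Z).subtypeL
  bounded := ⟨‖h‖, fun _ => ContinuousLinearMap.opNorm_le_bound _ (norm_nonneg h)
    (fun k => norm_comp_le k.1 h)⟩
  naturality k f := Category.assoc f k.1 h

/-- The pair `(X, e)` is an orthogonal sum of the family `A`: the `e i` are mutually orthogonal
isometries and the associated right and left multiplier maps are bijective for every object. -/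
structure IsOrthogonalSum (A : I → C) (X : C) (e : ∀ i, A i ⟶ X) : Prop where
  isometry : ∀ i, e i ≫ adj (e i) = 𝟙 (A i)
  orthogonal : ∀ i j, i ≠ j → e i ≫ adj (e j) = 0
  right_bijective : ∀ D : C, Function.Bijective (rightMultiplierMap e D)
  left_bijective : ∀ D : C, Function.Bijective (leftMultiplierMap e D)

end CStarCategory

/-!
An orthogonal sum can be characterised by families of morphisms. A right multiplier
`R : 𝕂(X, -) → Hom(D, -)` is determined by the components `r i = R (e i)^* : D ⟶ A i`, and the
families arising in this way are exactly those for which the finite partial sums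
`∑ i ∈ F, e i ∘ r i` are bounded in norm, uniformly in `F`
(`isBoundedFamily_component`, `IsBoundedFamily.exists_rightMultiplier`). Together with the fact that left
multipliers are the adjoints of right multipliers (`LeftMultiplier.toRight`) this gives
`isOrthogonalSum_iff`: orthogonal isometries `e i` form an orthogonal sum if and only if
every bounded family `r i : D ⟶ A i` is of the form `(e i)^* h` for a unique `h : D ⟶ X`.

A morphism of `C*`-categories is norm decreasing (`Morphism.norm_map_le`), because it restricts to
`*`-homomorphisms of the endomorphism `C*`-algebras; so it sends bounded families to bounded
families. If it is also fully faithful, then the unique solution `h` in the target comes from a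
unique solution in the source. Hence it detects orthogonal sums.

For preservation, let `(Y, f)` be an orthogonal sum of the images. The bounded family `φ(e i)^*`
yields `u : φ(X) ⟶ Y` with `(f i)^* u = φ(e i)^*`. Then `u u^*` is the identity by uniqueness in `Y`,
and `u^* u` is the image of an endomorphism of `X` which fixes each `e i`, hence is the
identity by uniqueness in `X`. So `u` is unitary and carries `φ(e i)` to `f i`, and being an
orthogonal sum is invariant under unitaries (`IsOrthogonalSum.of_unitary`).
-/

namespace CStarCategory

section Hom

variable {C : Type u} [Category.{v} C] [CStarCategory C]

/-! ### Elementary properties of the involution and of finite sums -/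

theorem zero_comp' {X Y Z : C} (g : Y ⟶ Z) : (0 : X ⟶ Y) ≫ g = 0 :=
  map_zero (postComp g X)

theorem comp_zero' {X Y Z : C} (f : X ⟶ Y) : f ≫ (0 : Y ⟶ Z) = 0 :=
  map_zero (preComp f Z)

theorem sum_comp' {ι : Type*} (s : Finset ι) {X Y Z : C} (f : ι → (X ⟶ Y)) (g : Y ⟶ Z) :
    (∑ i ∈ s, f i) ≫ g = ∑ i ∈ s, f i ≫ g :=
  map_sum (postComp g X) f s

theorem comp_sum' {ι : Type*} (s : Finset ι) {X Y Z : C} (f : X ⟶ Y) (g : ι → (Y ⟶ Z)) :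
    f ≫ (∑ i ∈ s, g i) = ∑ i ∈ s, f ≫ g i :=
  map_sum (preComp f Z) g s

theorem adj_zero {X Y : C} : adj (0 : X ⟶ Y) = 0 := by
  simpa using adj_smul (0 : ℂ) (0 : X ⟶ Y)

theorem adj_sum {ι : Type*} (s : Finset ι) {X Y : C} (f : ι → (X ⟶ Y)) :
    adj (∑ i ∈ s, f i) = ∑ i ∈ s, adj (f i) :=
  map_sum (AddMonoidHom.mk' (fun f : X ⟶ Y => adj f) adj_add) f s

theorem adj_injective {X Y : C} : Function.Injective (adj : (X ⟶ Y) → (Y ⟶ X)) :=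
  Function.LeftInverse.injective adj_adj

theorem norm_adj {X Y : C} (f : X ⟶ Y) : ‖adj f‖ = ‖f‖ := by
  have key : ∀ {X Y : C} (f : X ⟶ Y), ‖f‖ ≤ ‖adj f‖ := by
    intro X Y f
    have h1 := norm_comp_adj f
    have h2 := norm_comp_le f (adj f)
    rcases (norm_nonneg f).eq_or_lt with h | h
    · rw [← h]; exact norm_nonneg _
    · rw [h1, sq] at h2
      exact le_of_mul_le_mul_right h2 h
  refine le_antisymm ?_ (key f)
  simpa [adj_adj] using key (adj f)

/-! ### Endomorphism algebras and contractivity of morphisms -/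

/-- The endomorphisms of an object form a `C*`-algebra, with the product `a * b = b ≫ a` of
`CategoryTheory.End`. The unit is not recorded, as contractivity of `*`-homomorphisms does not
depend on it. -/
@[reducible]
def endCStarAlgebra (X : C) : NonUnitalCStarAlgebra (End X) :=
  { homNormed X X, homSpace X X with
    mul := fun a b => b ≫ a
    mul_assoc := fun a b c => (Category.assoc c b a).symm
    left_distrib := fun a b c => add_comp b c a
    right_distrib := fun a b c => comp_add c a b
    zero_mul := fun a => comp_zero' a
    mul_zero := fun a => zero_comp' a
    norm_mul_le := fun a b => norm_comp_le b a
    star := fun a => adj a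
    star_involutive := fun a => adj_adj a
    star_mul := fun a b => adj_comp b a
    star_add := adj_add
    norm_mul_self_le := fun a => by
      have h := norm_comp_adj (X := X) (Y := X) a
      rw [sq] at h
      exact h.ge
    star_smul := fun c a => adj_smul c a
    toCompleteSpace := homComplete X X
    smul_assoc := fun c a b => comp_smul c b a
    smul_comm := fun c a b => (smul_comp c b a).symm }

end Hom

section Morphism

variable {D : Type u₁} [Category.{v₁} D] [CStarCategory D]
  {C : Type u₂} [Category.{v₂} C] [CStarCategory C]

theorem Morphism.map_zero' (φ : Morphism D C) {X Y : D} : φ.map (0 : X ⟶ Y) = 0 :=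
  map_zero (AddMonoidHom.mk' (fun f : X ⟶ Y => φ.map f) φ.map_add')

theorem Morphism.map_sum' (φ : Morphism D C) {ι : Type*} (s : Finset ι) {X Y : D}
    (f : ι → (X ⟶ Y)) : φ.map (∑ i ∈ s, f i) = ∑ i ∈ s, φ.map (f i) :=
  map_sum (AddMonoidHom.mk' (fun f : X ⟶ Y => φ.map f) φ.map_add') f s

/-- By the `C*`-identity it suffices to treat `f^* f`, hence a `*`-homomorphism of endomorphism
algebras, which is automatically contractive. -/
theorem Morphism.norm_map_le (φ : Morphism D C) {X Y : D} (f : X ⟶ Y) : ‖φ.map f‖ ≤ ‖f‖ := by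
  let _ := endCStarAlgebra X
  let _ := endCStarAlgebra (φ.obj X)
  let ψ : End X →⋆ₙₐ[ℂ] End (φ.obj X) :=
    { toFun := fun a => φ.map a
      map_smul' := fun c a => φ.map_smul' c a
      map_zero' := φ.map_zero'
      map_add' := fun a b => φ.map_add' a b
      map_mul' := fun a b => φ.map_comp b a
      map_star' := fun a => φ.map_adj' a }
  have h : ‖φ.map (f ≫ adj f)‖ ≤ ‖f ≫ adj f‖ :=
    NonUnitalStarAlgHom.norm_apply_le (A := End X) (B := End (φ.obj X)) ψ (f ≫ adj f)
  rw [φ.map_comp, φ.map_adj', norm_comp_adj, norm_comp_adj] at h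
  exact le_of_sq_le_sq h (norm_nonneg f)

end Morphism

section Multiplier

variable {C : Type u} [Category.{v} C] [CStarCategory C] {I : Type w} {A : I → C} {X : C}
  {e : ∀ i, A i ⟶ X} {D : C}

/-! ### Left multipliers as adjoints of right multipliers -/

theorem adj_mem_compactTo {Z : C} {k : X ⟶ Z} (hk : k ∈ compactFrom e Z) :
    adj k ∈ compactTo e Z := by
  have hcont : Continuous (adj : (X ⟶ Z) → (Z ⟶ X)) :=
    (AddMonoidHomClass.isometry_of_norm
      (AddMonoidHom.mk' (fun f : X ⟶ Z => adj f) adj_add) norm_adj).continuous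
  refine (Submodule.isClosed_topologicalClosure _).preimage hcont |>.closure_subset_iff.2
    (fun k hk => ?_) hk
  refine Submodule.le_topologicalClosure _ ?_
  induction hk using Submodule.span_induction with
  | mem k hk =>
    obtain ⟨i, g, rfl⟩ := hk
    exact Submodule.subset_span ⟨i, adj g, by rw [adj_comp, adj_adj]⟩
  | zero => rw [adj_zero]; exact zero_mem _
  | add k k' _ _ h h' => rw [adj_add]; exact add_mem h h'
  | smul c k _ h => rw [adj_smul]; exact Submodule.smul_mem _ _ h

theorem adj_mem_compactFrom {Z : C} {k : Z ⟶ X} (hk : k ∈ compactTo e Z) :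
    adj k ∈ compactFrom e Z := by
  have hcont : Continuous (adj : (Z ⟶ X) → (X ⟶ Z)) :=
    (AddMonoidHomClass.isometry_of_norm
      (AddMonoidHom.mk' (fun f : Z ⟶ X => adj f) adj_add) norm_adj).continuous
  refine (Submodule.isClosed_topologicalClosure _).preimage hcont |>.closure_subset_iff.2
    (fun k hk => ?_) hk
  refine Submodule.le_topologicalClosure _ ?_
  induction hk using Submodule.span_induction with
  | mem k hk =>
    obtain ⟨i, g, rfl⟩ := hk
    exact Submodule.subset_span ⟨i, adj g, adj_comp _ _⟩
  | zero => rw [adj_zero]; exact zero_mem _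
  | add k k' _ _ h h' => rw [adj_add]; exact add_mem h h'
  | smul c k _ h => rw [adj_smul]; exact Submodule.smul_mem _ _ h

/-- The right multiplier `k ↦ L(k^*)^*` associated with a left multiplier `L`. -/
noncomputable def LeftMultiplier.toRight (L : LeftMultiplier e D) : RightMultiplier e D where
  app Z := LinearMap.mkContinuous
    { toFun := fun k => adj (L.app Z ⟨adj k.1, adj_mem_compactTo k.2⟩)
      map_add' := fun k k' => by
        rw [← adj_add, ← map_add]
        congr 2
        exact Subtype.ext (adj_add _ _)
      map_smul' := fun c k => by
        have h : (⟨adj (c • k).1, adj_mem_compactTo (c • k).2⟩ : compactTo e Z) =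
            starRingEnd ℂ c • ⟨adj k.1, adj_mem_compactTo k.2⟩ :=
          Subtype.ext (adj_smul _ _)
        rw [h, map_smul, adj_smul, Complex.conj_conj]
        rfl }
    ‖L.app Z‖ (fun k => by
      refine (norm_adj _).trans_le ((L.app Z).le_opNorm _ |>.trans_eq ?_)
      exact congrArg _ (norm_adj k.1))
  bounded := by
    obtain ⟨K, hK⟩ := L.bounded
    refine ⟨K, fun Z => le_trans ?_ (hK Z)⟩
    exact LinearMap.mkContinuous_norm_le _ (L.app Z).opNorm_nonneg _
  naturality {Z W} k f := by
    have hk : (⟨adj (k.1 ≫ f), adj_mem_compactTo (comp_mem_compactFrom e k.2 f)⟩ :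
        compactTo e W) = ⟨adj f ≫ adj k.1, comp_mem_compactTo e (adj_mem_compactTo k.2) _⟩ :=
      Subtype.ext (adj_comp _ _)
    have h := L.naturality ⟨adj k.1, adj_mem_compactTo k.2⟩ (adj f)
    exact (congrArg (fun x => adj (L.app W x)) hk).trans
      ((congrArg adj h).trans (by rw [adj_comp, adj_adj]; rfl))

theorem LeftMultiplier.toRight_injective :
    Function.Injective (LeftMultiplier.toRight : LeftMultiplier e D → RightMultiplier e D) := by
  intro L L' h
  ext Z k
  have h' : adj (L.app Z ⟨adj (adj k.1), _⟩) = adj (L'.app Z ⟨adj (adj k.1), _⟩) :=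
    congrArg (fun R : RightMultiplier e D => R.app Z ⟨adj k.1, adj_mem_compactFrom k.2⟩) h
  have hk : (⟨adj (adj k.1), adj_mem_compactTo (adj_mem_compactFrom k.2)⟩ : compactTo e Z) = k :=
    Subtype.ext (adj_adj _)
  rw [hk] at h'
  exact adj_injective h'

theorem toRight_leftMultiplierMap (h : X ⟶ D) :
    (leftMultiplierMap e D h).toRight = rightMultiplierMap e D (adj h) := by
  ext Z k
  change adj (adj k.1 ≫ h) = adj h ≫ k.1
  rw [adj_comp, adj_adj]

/-- The condition on left multipliers in the definition of an orthogonal sum is a consequence of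
the one on right multipliers. -/
theorem leftMultiplierMap_bijective (h : Function.Bijective (rightMultiplierMap e D)) :
    Function.Bijective (leftMultiplierMap e D) := by
  constructor
  · intro a b hab
    refine adj_injective (h.1 ?_)
    rw [← toRight_leftMultiplierMap, ← toRight_leftMultiplierMap, hab]
  · intro L
    obtain ⟨a, ha⟩ := h.2 L.toRight
    refine ⟨adj a, LeftMultiplier.toRight_injective ?_⟩
    rw [toRight_leftMultiplierMap, adj_adj, ha]

/-! ### Right multipliers as bounded families of morphisms -/

theorem adj_comp_mem_compactFrom (e : ∀ i, A i ⟶ X) (i : I) {Z : C} (g : A i ⟶ Z) :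
    adj (e i) ≫ g ∈ compactFrom e Z :=
  Submodule.le_topologicalClosure _ (Submodule.subset_span ⟨i, g, rfl⟩)

theorem adj_mem_compactFrom_self (e : ∀ i, A i ⟶ X) (i : I) :
    adj (e i) ∈ compactFrom e (A i) := by
  simpa using adj_comp_mem_compactFrom e i (𝟙 (A i))

/-- The component `R(e_i^*) : D ⟶ A i` of a right multiplier. -/
def RightMultiplier.component (R : RightMultiplier e D) (i : I) : D ⟶ A i :=
  R.app (A i) ⟨adj (e i), adj_mem_compactFrom_self e i⟩

theorem RightMultiplier.app_adj_comp (R : RightMultiplier e D) (i : I) {Z : C} (g : A i ⟶ Z) :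
    R.app Z ⟨adj (e i) ≫ g, adj_comp_mem_compactFrom e i g⟩ = R.component i ≫ g :=
  R.naturality ⟨adj (e i), adj_mem_compactFrom_self e i⟩ g

/-- A right multiplier is determined by its components, since the morphisms `g e_i^*` span a
dense subspace. -/
theorem RightMultiplier.ext_component {R R' : RightMultiplier e D}
    (h : ∀ i, R.component i = R'.component i) : R = R' := by
  ext Z ⟨k, hk⟩
  -- The equalizer of the two multipliers, as a closed subset of `𝕂(X, Z)`, contains the span.
  have hspan : ∀ (k : X ⟶ Z) (hk' : k ∈ Submodule.span ℂ {f | ∃ (i : I) (g : A i ⟶ Z),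
      f = adj (e i) ≫ g}), R.app Z ⟨k, Submodule.le_topologicalClosure _ hk'⟩ =
        R'.app Z ⟨k, Submodule.le_topologicalClosure _ hk'⟩ := by
    intro k hk'
    induction hk' using Submodule.span_induction with
    | mem k hk =>
      obtain ⟨i, g, rfl⟩ := hk
      exact (R.app_adj_comp i g).trans ((h i ▸ rfl : _ = _).trans (R'.app_adj_comp i g).symm)
    | zero => exact (map_zero (R.app Z)).trans (map_zero (R'.app Z)).symm
    | add k k' _ _ h h' =>
      exact (map_add (R.app Z) ⟨k, _⟩ ⟨k', _⟩).trans
        ((congrArg₂ _ h h').trans (map_add (R'.app Z) ⟨k, _⟩ ⟨k', _⟩).symm)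
    | smul c k _ h =>
      exact (map_smul (R.app Z) c ⟨k, _⟩).trans
        ((congrArg _ h).trans (map_smul (R'.app Z) c ⟨k, _⟩).symm)
  obtain ⟨u, hu, hlim⟩ := mem_closure_iff_seq_limit.1 hk
  have hlim' : Filter.Tendsto
      (fun n => (⟨u n, Submodule.le_topologicalClosure _ (hu n)⟩ : compactFrom e Z))
      Filter.atTop (nhds ⟨k, hk⟩) := tendsto_subtype_rng.2 hlim
  refine tendsto_nhds_unique (((R.app Z).continuous.tendsto _).comp hlim') ?_
  refine (((R'.app Z).continuous.tendsto _).comp hlim').congr fun n => ?_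
  exact (hspan (u n) (hu n)).symm

theorem component_rightMultiplierMap (h : D ⟶ X) (i : I) :
    (rightMultiplierMap e D h).component i = h ≫ adj (e i) := rfl

/-- A family of morphisms `r i : D ⟶ A i` is bounded with respect to `e i : A i ⟶ X` if the
finite partial sums of `∑ e_i r_i` are uniformly bounded in norm. -/
def IsBoundedFamily (e : ∀ i, A i ⟶ X) (r : ∀ i, D ⟶ A i) : Prop :=
  ∃ K : ℝ, ∀ F : Finset I, ‖∑ i ∈ F, r i ≫ e i‖ ≤ K

theorem sum_comp_adj (iso : ∀ i, e i ≫ adj (e i) = 𝟙 (A i))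
    (orth : ∀ i j, i ≠ j → e i ≫ adj (e j) = 0) (r : ∀ i, D ⟶ A i) {F : Finset I} {j : I}
    (hj : j ∈ F) : (∑ i ∈ F, r i ≫ e i) ≫ adj (e j) = r j := by
  rw [sum_comp', Finset.sum_eq_single j]
  · rw [Category.assoc, iso, Category.comp_id]
  · intro i _ hij
    rw [Category.assoc, orth i j hij, comp_zero']
  · exact fun h => absurd hj h

/-- The components of a right multiplier `R` form a bounded family: the partial sum `s` of
`∑ e_i r_i` satisfies `‖s‖² = ‖s^* s‖ = ‖R(s^*)‖ ≤ K ‖s‖`. -/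
theorem isBoundedFamily_component (iso : ∀ i, e i ≫ adj (e i) = 𝟙 (A i))
    (orth : ∀ i j, i ≠ j → e i ≫ adj (e j) = 0) (R : RightMultiplier e D) :
    IsBoundedFamily e R.component := by
  obtain ⟨K, hK⟩ := R.bounded
  refine ⟨K, fun F => ?_⟩
  set s := ∑ i ∈ F, R.component i ≫ e i with hs
  let t : compactFrom e D :=
    ∑ i ∈ F, ⟨adj (e i) ≫ adj (R.component i), adj_comp_mem_compactFrom e i _⟩
  have ht : (t : X ⟶ D) = adj s := by
    rw [hs, adj_sum, AddSubmonoidClass.coe_finsetSum]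
    exact Finset.sum_congr rfl fun i _ => (adj_comp _ _).symm
  have hRt : R.app D t = s ≫ adj s := by
    rw [map_sum]
    conv_rhs => rw [← ht, AddSubmonoidClass.coe_finsetSum, comp_sum']
    refine Finset.sum_congr rfl fun i hi => ?_
    rw [R.app_adj_comp, ← Category.assoc, sum_comp_adj iso orth _ hi]
  have hle : ‖s‖ ^ 2 ≤ K * ‖s‖ := by
    rw [← norm_comp_adj, ← hRt, ← norm_adj s, ← ht]
    exact ((R.app D).le_opNorm t).trans (mul_le_mul_of_nonneg_right (hK D) (norm_nonneg _))
  rcases (norm_nonneg s).eq_or_lt with h | h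
  · rw [← h]
    exact (R.app D).opNorm_nonneg.trans (hK D)
  · rw [sq] at hle
    exact le_of_mul_le_mul_right hle h

/-- The finite partial sums of `∑ e_i r_i` converge pointwise on `𝕂(X, -)`: composed with a
linear combination of morphisms `g e_i^*` they are eventually constant, and they are uniformly
bounded. -/
theorem IsBoundedFamily.exists_tendsto (iso : ∀ i, e i ≫ adj (e i) = 𝟙 (A i))
    (orth : ∀ i j, i ≠ j → e i ≫ adj (e j) = 0) {r : ∀ i, D ⟶ A i} (hr : IsBoundedFamily e r)
    {Z : C} {k : X ⟶ Z} (hk : k ∈ compactFrom e Z) :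
    ∃ l : D ⟶ Z, Filter.Tendsto (fun F : Finset I => (∑ i ∈ F, r i ≫ e i) ≫ k) Filter.atTop
      (nhds l) := by
  classical
  obtain ⟨K, hK⟩ := hr
  have hK0 : 0 ≤ K := (norm_nonneg _).trans (hK ∅)
  have hspan : ∀ k ∈ Submodule.span ℂ {f | ∃ (i : I) (g : A i ⟶ Z), f = adj (e i) ≫ g},
      ∃ l : D ⟶ Z, Filter.Tendsto (fun F : Finset I => (∑ i ∈ F, r i ≫ e i) ≫ k) Filter.atTop
        (nhds l) := by
    intro k hk
    induction hk using Submodule.span_induction with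
    | mem k hk =>
      obtain ⟨j, g, rfl⟩ := hk
      refine ⟨r j ≫ g, tendsto_const_nhds.congr' ?_⟩
      filter_upwards [Filter.eventually_ge_atTop {j}] with F hF
      rw [← Category.assoc, sum_comp_adj iso orth r (Finset.singleton_subset_iff.1 hF)]
    | zero => exact ⟨0, by simp only [comp_zero']; exact tendsto_const_nhds⟩
    | add k k' _ _ h h' =>
      obtain ⟨⟨l, hl⟩, ⟨l', hl'⟩⟩ := h, h'
      exact ⟨l + l', by simp only [comp_add]; exact hl.add hl'⟩
    | smul c k _ h =>
      obtain ⟨l, hl⟩ := h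
      exact ⟨c • l, by simp only [comp_smul]; exact hl.const_smul c⟩
  refine cauchySeq_tendsto_of_complete (Metric.cauchySeq_iff'.2 fun ε hε => ?_)
  obtain ⟨k', hk', hkk'⟩ := Metric.mem_closure_iff.1 hk (ε / (3 * (K + 1))) (by positivity)
  obtain ⟨l, hl⟩ := hspan k' hk'
  obtain ⟨N, hN⟩ := Metric.cauchySeq_iff'.1 hl.cauchySeq (ε / 3) (by positivity)
  have hclose : ∀ F : Finset I,
      dist ((∑ i ∈ F, r i ≫ e i) ≫ k) ((∑ i ∈ F, r i ≫ e i) ≫ k') < ε / 3 := by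
    intro F
    rw [dist_eq_norm]
    have hsub : (∑ i ∈ F, r i ≫ e i) ≫ k - (∑ i ∈ F, r i ≫ e i) ≫ k' =
        (∑ i ∈ F, r i ≫ e i) ≫ (k - k') := (map_sub (preComp _ Z) k k').symm
    rw [hsub]
    calc _ ≤ ‖k - k'‖ * ‖∑ i ∈ F, r i ≫ e i‖ := norm_comp_le _ _
      _ ≤ ‖k - k'‖ * (K + 1) :=
        mul_le_mul_of_nonneg_left ((hK F).trans (by linarith)) (norm_nonneg _)
      _ < ε / (3 * (K + 1)) * (K + 1) := by
        rw [← dist_eq_norm]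
        exact mul_lt_mul_of_pos_right hkk' (by positivity)
      _ = ε / 3 := by field_simp
  refine ⟨N, fun F hF => ?_⟩
  have h1 := hclose F
  have h2 := hN F hF
  have h3 := hclose N
  rw [dist_comm] at h3
  have h4 := dist_triangle4 ((∑ i ∈ F, r i ≫ e i) ≫ k) ((∑ i ∈ F, r i ≫ e i) ≫ k')
    ((∑ i ∈ N, r i ≫ e i) ≫ k') ((∑ i ∈ N, r i ≫ e i) ≫ k)
  linarith

/-- Every bounded family consists of the components of a right multiplier. -/
theorem IsBoundedFamily.exists_rightMultiplier (iso : ∀ i, e i ≫ adj (e i) = 𝟙 (A i))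
    (orth : ∀ i j, i ≠ j → e i ≫ adj (e j) = 0) {r : ∀ i, D ⟶ A i} (hr : IsBoundedFamily e r) :
    ∃ R : RightMultiplier e D, ∀ i, R.component i = r i := by
  classical
  choose l hl using fun (Z : C) (k : compactFrom e Z) => hr.exists_tendsto iso orth k.2
  obtain ⟨K, hK⟩ := hr
  have hK0 : 0 ≤ K := (norm_nonneg _).trans (hK ∅)
  have hbound : ∀ (Z : C) (k : compactFrom e Z), ‖l Z k‖ ≤ K * ‖k‖ := fun Z k =>
    le_of_tendsto (hl Z k).norm (Filter.Eventually.of_forall fun F =>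
      (norm_comp_le _ _).trans ((mul_comm _ _).trans_le
        (mul_le_mul_of_nonneg_right (hK F) (norm_nonneg _))))
  let R : RightMultiplier e D :=
    { app := fun Z => LinearMap.mkContinuous
        { toFun := l Z
          map_add' := fun k k' => tendsto_nhds_unique (hl Z (k + k'))
            (((hl Z k).add (hl Z k')).congr fun F => (comp_add _ k.1 k'.1).symm)
          map_smul' := fun c k => tendsto_nhds_unique (hl Z (c • k))
            (((hl Z k).const_smul c).congr fun F => (comp_smul c _ k.1).symm) }
        K (hbound Z)
      bounded := ⟨K, fun Z => LinearMap.mkContinuous_norm_le _ hK0 _⟩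
      naturality := fun {Z W} k f => tendsto_nhds_unique (hl W _)
        ((((postComp f D).continuous.tendsto _).comp (hl Z k)).congr fun F =>
          Category.assoc _ k.1 f) }
  refine ⟨R, fun i => tendsto_nhds_unique (hl (A i) _) (tendsto_const_nhds.congr' ?_)⟩
  filter_upwards [Filter.eventually_ge_atTop {i}] with F hF
  exact (sum_comp_adj iso orth r (Finset.singleton_subset_iff.1 hF)).symm

/-- An orthogonal sum is a family of orthogonal isometries such that every bounded family of
morphisms into the summands factors uniquely through it. -/
theorem isOrthogonalSum_iff : IsOrthogonalSum A X e ↔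
    (∀ i, e i ≫ adj (e i) = 𝟙 (A i)) ∧ (∀ i j, i ≠ j → e i ≫ adj (e j) = 0) ∧
      ∀ (D : C) (r : ∀ i, D ⟶ A i), IsBoundedFamily e r →
        ∃! h : D ⟶ X, ∀ i, h ≫ adj (e i) = r i := by
  constructor
  · intro H
    refine ⟨H.isometry, H.orthogonal, fun D r hr => ?_⟩
    obtain ⟨R, hR⟩ := hr.exists_rightMultiplier H.isometry H.orthogonal
    obtain ⟨h, rfl⟩ := (H.right_bijective D).2 R
    refine ⟨h, hR, fun h' hh' => (H.right_bijective D).1 ?_⟩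
    exact RightMultiplier.ext_component fun i => (hh' i).trans (hR i).symm
  · rintro ⟨iso, orth, H⟩
    have hbij : ∀ D : C, Function.Bijective (rightMultiplierMap e D) := by
      intro D
      have key := fun R : RightMultiplier e D =>
        H D R.component (isBoundedFamily_component iso orth R)
      constructor
      · intro h h' hh'
        refine (key (rightMultiplierMap e D h')).unique (fun i => ?_) (fun i => rfl)
        exact congrArg (fun R : RightMultiplier e D => R.component i) hh'
      · intro R
        obtain ⟨h, hh, -⟩ := key R
        exact ⟨h, RightMultiplier.ext_component hh⟩
    exact ⟨iso, orth, hbij, fun D => leftMultiplierMap_bijective (hbij D)⟩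

theorem IsOrthogonalSum.existsUnique (H : IsOrthogonalSum A X e) {r : ∀ i, D ⟶ A i}
    (hr : IsBoundedFamily e r) : ∃! h : D ⟶ X, ∀ i, h ≫ adj (e i) = r i :=
  (isOrthogonalSum_iff.1 H).2.2 D r hr

/-- The composites of a morphism `h` with the `e_i^*` form a bounded family, as they are the
components of the right multiplier defined by `h`. -/
theorem isBoundedFamily_comp_adj (iso : ∀ i, e i ≫ adj (e i) = 𝟙 (A i))
    (orth : ∀ i j, i ≠ j → e i ≫ adj (e j) = 0) (h : D ⟶ X) :
    IsBoundedFamily e (fun i => h ≫ adj (e i)) :=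
  isBoundedFamily_component iso orth (rightMultiplierMap e D h)

theorem IsOrthogonalSum.hom_ext (H : IsOrthogonalSum A X e) {h h' : D ⟶ X}
    (hh : ∀ i, h ≫ adj (e i) = h' ≫ adj (e i)) : h = h' :=
  (H.existsUnique (isBoundedFamily_comp_adj H.isometry H.orthogonal h')).unique hh fun _ => rfl

/-- The norms of the partial sums of `∑ e_i r_i` do not depend on the orthogonal isometries
`e i`. -/
theorem IsBoundedFamily.congr {Y : C} {f : ∀ i, A i ⟶ Y}
    (iso : ∀ i, e i ≫ adj (e i) = 𝟙 (A i)) (orth : ∀ i j, i ≠ j → e i ≫ adj (e j) = 0)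
    (iso' : ∀ i, f i ≫ adj (f i) = 𝟙 (A i)) (orth' : ∀ i j, i ≠ j → f i ≫ adj (f j) = 0)
    {r : ∀ i, D ⟶ A i} (hr : IsBoundedFamily e r) : IsBoundedFamily f r := by
  obtain ⟨K, hK⟩ := hr
  refine ⟨K, fun F => le_of_eq_of_le ?_ (hK F)⟩
  refine (sq_eq_sq₀ (norm_nonneg _) (norm_nonneg _)).1 ?_
  rw [← norm_comp_adj, ← norm_comp_adj, adj_sum, adj_sum, comp_sum', comp_sum']
  refine congrArg _ (Finset.sum_congr rfl fun i hi => ?_)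
  rw [adj_comp, adj_comp, ← Category.assoc, ← Category.assoc, sum_comp_adj iso orth r hi,
    sum_comp_adj iso' orth' r hi]

theorem IsOrthogonalSum.of_unitary {Y : C} {f : ∀ i, A i ⟶ Y} (H : IsOrthogonalSum A Y f)
    (iso : ∀ i, e i ≫ adj (e i) = 𝟙 (A i)) (orth : ∀ i j, i ≠ j → e i ≫ adj (e j) = 0)
    {u : X ⟶ Y} (hu : u ≫ adj u = 𝟙 X) (hu' : adj u ≫ u = 𝟙 Y)
    (hef : ∀ i, u ≫ adj (f i) = adj (e i)) : IsOrthogonalSum A X e := by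
  refine isOrthogonalSum_iff.2 ⟨iso, orth, fun D r hr => ?_⟩
  obtain ⟨h, hh, huniq⟩ := H.existsUnique (hr.congr iso orth H.isometry H.orthogonal)
  refine ⟨h ≫ adj u, fun i => ?_, fun h' hh' => ?_⟩
  · rw [← hef, Category.assoc, ← Category.assoc (adj u), hu', Category.id_comp, hh]
  · rw [← huniq (h' ≫ u) fun i => by rw [Category.assoc, hef, hh'], Category.assoc, hu,
      Category.comp_id]

end Multiplier

/-! ### Fully faithful morphisms and orthogonal sums -/

section FullyFaithful

variable {D : Type u₁} [Category.{v₁} D] [CStarCategory D]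
  {C : Type u₂} [Category.{v₂} C] [CStarCategory C] (φ : Morphism D C) {I : Type w}
  {A : I → D} {X : D} {e : ∀ i, A i ⟶ X}

/-- Morphisms of `C*`-categories preserve bounded families, since they are contractive. -/
theorem IsBoundedFamily.map {Z : D} {r : ∀ i, Z ⟶ A i} (hr : IsBoundedFamily e r) :
    IsBoundedFamily (A := fun i => φ.obj (A i)) (fun i => φ.map (e i))
      (fun i => φ.map (r i)) := by
  obtain ⟨K, hK⟩ := hr
  refine ⟨K, fun F => le_trans (le_of_eq_of_le ?_ (φ.norm_map_le _)) (hK F)⟩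
  rw [φ.map_sum']
  exact congrArg _ (Finset.sum_congr rfl fun i _ => (φ.map_comp _ _).symm)

variable [φ.toFunctor.Full] [φ.toFunctor.Faithful]

theorem IsOrthogonalSum.of_map
    (H : IsOrthogonalSum (fun i => φ.obj (A i)) (φ.obj X) (fun i => φ.map (e i))) :
    IsOrthogonalSum A X e := by
  refine isOrthogonalSum_iff.2 ⟨fun i => φ.map_injective ?_, fun i j hij => φ.map_injective ?_,
    fun Z r hr => ?_⟩
  · rw [φ.map_comp, φ.map_adj', φ.map_id]
    exact H.isometry i
  · rw [φ.map_comp, φ.map_adj', φ.map_zero']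
    exact H.orthogonal i j hij
  · obtain ⟨h, hh, huniq⟩ := H.existsUnique (hr.map φ)
    obtain ⟨h, rfl⟩ := φ.map_surjective h
    refine ⟨h, fun i => φ.map_injective ?_, fun h' hh' => φ.map_injective (huniq _ fun i => ?_)⟩
    · rw [φ.map_comp, φ.map_adj']
      exact hh i
    · rw [← φ.map_adj', ← φ.map_comp, hh']

/-- The unitary comparing the two candidates is obtained from the family `φ(e_i)^*`, which is
bounded as it corresponds to the identity of `φ(X)`. -/
theorem IsOrthogonalSum.map (H : IsOrthogonalSum A X e) {Y : C} {f : ∀ i, φ.obj (A i) ⟶ Y}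
    (HY : IsOrthogonalSum (fun i => φ.obj (A i)) Y f) :
    IsOrthogonalSum (fun i => φ.obj (A i)) (φ.obj X) (fun i => φ.map (e i)) := by
  have iso : ∀ i, φ.map (e i) ≫ adj (φ.map (e i)) = 𝟙 (φ.obj (A i)) := fun i => by
    rw [← φ.map_adj', ← φ.map_comp, H.isometry, φ.map_id]
  have orth : ∀ i j, i ≠ j → φ.map (e i) ≫ adj (φ.map (e j)) = 0 := fun i j hij => by
    rw [← φ.map_adj', ← φ.map_comp, H.orthogonal i j hij, φ.map_zero']
  have hbdd : IsBoundedFamily (A := fun i => φ.obj (A i)) (fun i => φ.map (e i))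
      (fun i => adj (φ.map (e i))) := by
    simpa only [Category.id_comp] using isBoundedFamily_comp_adj iso orth (𝟙 (φ.obj X))
  obtain ⟨u, hu, -⟩ := HY.existsUnique (hbdd.congr iso orth HY.isometry HY.orthogonal)
  -- `u` carries `φ(e_i)` to `f_i`: both have the same composites with all `f_j^*`.
  have huf : ∀ i, φ.map (e i) ≫ u = f i := fun i => HY.hom_ext fun j => by
    rw [Category.assoc, hu]
    by_cases hij : i = j
    · subst hij
      rw [iso, HY.isometry]
    · rw [orth i j hij, HY.orthogonal i j hij]
  have huf' : ∀ i, adj u ≫ adj (φ.map (e i)) = adj (f i) := fun i => by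
    rw [← adj_comp, huf]
  refine HY.of_unitary iso orth (u := u) ?_ ?_ hu
  · -- Uniqueness applies in the source category, where `u^* u` has a preimage.
    obtain ⟨p, hp⟩ := φ.map_surjective (u ≫ adj u)
    have hp1 : p = 𝟙 X := H.hom_ext fun i => φ.map_injective (by
      rw [φ.map_comp, hp, φ.map_adj', Category.assoc, huf', hu, Category.id_comp, φ.map_adj'])
    rw [← hp, hp1, φ.map_id]
  · exact HY.hom_ext fun i => by rw [Category.assoc, hu, huf', Category.id_comp]

end FullyFaithful

end CStarCategory

theorem mainTheorem9
    {D : Type u₁} [Category.{v₁} D] [CStarCategory D]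
    {C : Type u₂} [Category.{v₂} C] [CStarCategory C]
    (φ : CStarCategory.Morphism D C) [φ.toFunctor.Full] [φ.toFunctor.Faithful]
    {I : Type w} (A : I → D) (X : D) (e : ∀ i, A i ⟶ X) :
    (CStarCategory.IsOrthogonalSum (fun i => φ.obj (A i)) (φ.obj X) (fun i => φ.map (e i)) →
      CStarCategory.IsOrthogonalSum A X e) ∧
    (CStarCategory.IsOrthogonalSum A X e →
      (∃ (Y : C) (f : ∀ i, φ.obj (A i) ⟶ Y),
        CStarCategory.IsOrthogonalSum (fun i => φ.obj (A i)) Y f) →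
      CStarCategory.IsOrthogonalSum (fun i => φ.obj (A i)) (φ.obj X)
        (fun i => φ.map (e i))) :=
  ⟨fun H => H.of_map φ, fun H ⟨_, _, HY⟩ => H.map φ HY⟩
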